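/- Let $n,p,d\ge 0$ be integers with $n<d$, let $F$ be a separable real Banach space, let $B^n\subset\mathbb{R}^n$ be the open Euclidean unit ball and $\bar B^n$ the closed one. **Spaces.** For an integer $r\ge 0$, $C^r(\bar B^n,F)$ is the separable Banach space of maps which are $C^r$ on $B^n$ and whose differentials of order $0,\dots,r$ extend continuously to $\bar B^n$, with norm the sum over $0\le k\le r$ of $\sup_{\bar B^n}\|D^kf\|$. The space of $p$-jets is $J^p(\bar B^n,F)=\bar B^n\times F\times L(\mathbb{R}^n,F)\times\dots\times L^p_{\mathrm{sym}}(\mathbb{R}^n,F)$, where $L^k_{\mathrm{sym}}(\mathbb{R}^n,F)$ is the space of symmetric $k$-linear maps; it is a subset of the Banach space $J^p(\mathbb{R}^n,F)=\mathbb{R}^n\times F\times\dots\times L^p_{\mathrm{sym}}(\mathbb{R}^n,F)$. For $f\in C^{p+1}(\bar B^n,F)$ and $x\in B^n$ put $j^p_xf=(x,f(x),Df(x),\dots,D^pf(x))$, and $j^pf(B^n)=\{j^p_xf : x\in B^n\}$. **Rectifiable sets.** A subset $S$ of a Banach space $Y$ is a Lipschitz graph of codimension $c$ if there are a topological splitting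 $Y=E\oplus G$ with $\dim G=c$ and a Lipschitz map $g:E\to G$ such that $S\subset\{x+g(x):x\in E\}$. A Fredholm map of index $i$ from an open subset $U$ of a Banach space to a Banach space $X$ is a $C^1$ map $\varphi:U\to X$ whose differential at every point of $U$ is a Fredholm operator of index $i$ (index $=\dim\ker-\operatorname{codim}\operatorname{range}$). A subset $A$ of a separable Banach space $X$ is rectifiable of codimension $d$ if it is a countable (possibly empty) union $A=\bigcup_m\varphi_m(A_m)$, where $\varphi_m:U_m\to X$ is a Fredholm map of some index $i_m\in\mathbb{Z}$ defined on an open subset $U_m$ of a separable Banach space $F_m$, and $A_m\subset U_m$ is a Lipschitz graph of codimension $d+i_m$ in $F_m$. A subset of $J^p(\bar B^n,F)$ is called rectifiable of codimension $d$ if it is so as a subset of the Banach space $J^p(\mathbb{R}^n,F)$. **Statement.** Let $A\subset J^p(\bar B^n,F)$ be rectifiable of codimension $d$. Then the set $$\mathcal{A}=\{f\in C^{p+1}(\bar B^n,F) : j^pf(B^n)\cap A\ne\emptyset\}$$ is rectifiable of codimension $d-n$ in $C^{p+1}(\bar B^n,F)$. -/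

import Mathlib

open Set Metric Topology
open scoped ContDiff

universe u

noncomputable section

namespace RectJets

/-! ### Rectifiable sets in Banach spaces -/

section Rectifiable

/-- The index `dim ker L - codim range L` (meaningful for Fredholm operators `L`). -/
def fredholmIndex {Y X : Type*} [NormedAddCommGroup Y] [NormedSpace ℝ Y]
    [NormedAddCommGroup X] [NormedSpace ℝ X] (L : Y →L[ℝ] X) : ℤ :=
  (Module.finrank ℝ (LinearMap.ker L.toLinearMap) : ℤ) -
    (Module.finrank ℝ (X ⧸ LinearMap.range L.toLinearMap) : ℤ)

/-- `φ` restricts to a (nonlinear) Fredholm map of index `i` on the open set `U`: it is `C^1` on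
`U` and its differential at every point of `U` is a Fredholm operator of index `i`. -/
def IsFredholmMapOn {Y X : Type*} [NormedAddCommGroup Y] [NormedSpace ℝ Y]
    [NormedAddCommGroup X] [NormedSpace ℝ X] (φ : Y → X) (U : Set Y) (i : ℤ) : Prop :=
  IsOpen U ∧ ContDiffOn ℝ 1 φ U ∧
    ∀ y ∈ U, (fderiv ℝ φ y).IsFredholm ∧ fredholmIndex (fderiv ℝ φ y) = i

/-- `B` is a Lipschitz graph of codimension `c` in `Y`: there are a topological splitting
`Y = E ⊕ G` with `G` of finite dimension `c`, and a Lipschitz map `g : E → G`, such that `B` is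
contained in `{x + g x | x ∈ E}`. The number `c` is an integer; there are no Lipschitz graphs of
negative codimension. -/
def IsLipschitzGraph {Y : Type*} [NormedAddCommGroup Y] [NormedSpace ℝ Y]
    (c : ℤ) (B : Set Y) : Prop :=
  ∃ E G : Submodule ℝ Y,
    IsCompl E G ∧ IsClosed (E : Set Y) ∧ FiniteDimensional ℝ G ∧
    (Module.finrank ℝ G : ℤ) = c ∧
    ∃ g : E → G, (∃ K : NNReal, LipschitzWith K g) ∧
      B ⊆ {y | ∃ x : E, y = (x : Y) + (g x : Y)}

/-- `S = φ(B)`, where `φ` is a Fredholm map of some index `i` from an open subset `U` of a separable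
Banach space `Y` to `X`, and `B ⊆ U` is a Lipschitz graph of codimension `d + i` in `Y`. -/
def IsRectifiablePiece {X : Type u} [NormedAddCommGroup X] [NormedSpace ℝ X]
    (d : ℕ) (S : Set X) : Prop :=
  ∃ (Y : Type u) (_ : NormedAddCommGroup Y) (_ : NormedSpace ℝ Y)
    (_ : CompleteSpace Y) (_ : TopologicalSpace.SeparableSpace Y)
    (U : Set Y) (φ : Y → X) (i : ℤ) (B : Set Y),
    IsFredholmMapOn φ U i ∧ B ⊆ U ∧ IsLipschitzGraph ((d : ℤ) + i) B ∧ S = φ '' B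

/-- A subset of a separable Banach space `X` is rectifiable of codimension `d` if it is a countable
union of images of Lipschitz graphs of codimension `d + i` under Fredholm maps of index `i` (the
index `i` may vary from piece to piece). The empty union is allowed. -/
def IsRectifiable {X : Type u} [NormedAddCommGroup X] [NormedSpace ℝ X]
    (d : ℕ) (A : Set X) : Prop :=
  ∃ 𝒮 : Set (Set X), 𝒮.Countable ∧ (∀ S ∈ 𝒮, IsRectifiablePiece d S) ∧ A = ⋃₀ 𝒮

end Rectifiable

/-! ### Symmetry of higher derivatives of real `C^k` maps -/

section Symmetry

variable {E F : Type*} [NormedAddCommGroup E] [NormedSpace ℝ E]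
  [NormedAddCommGroup F] [NormedSpace ℝ F]

/-- The `k`-th derivative of a real `C^k` map is a symmetric multilinear map. -/
theorem iteratedFDeriv_symm_of_contDiffAt {f : E → F} (k : ℕ) {x : E}
    (hf : ContDiffAt ℝ k f x) (σ : Equiv.Perm (Fin k)) (v : Fin k → E) :
    iteratedFDeriv ℝ k f x (v ∘ σ) = iteratedFDeriv ℝ k f x v := by
  induction k generalizing x with
  | zero => rw [Subsingleton.elim (v ∘ σ) v]
  | succ k ih =>
    have hσ : σ ∈ Submonoid.closure
        (Set.range fun i : Fin k => Equiv.swap i.castSucc i.succ) := by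
      rw [Equiv.Perm.mclosure_swap_castSucc_succ]; trivial
    induction hσ using Submonoid.closure_induction generalizing v with
    | one => rfl
    | mul σ τ _ _ hσ hτ =>
      have h : v ∘ (σ * τ : Equiv.Perm (Fin (k + 1))) = (v ∘ σ) ∘ τ := rfl
      rw [h, hτ, hσ]
    | mem s hs =>
      obtain ⟨i, rfl⟩ := hs
      have hf' : ContDiffAt ℝ k f x := hf.of_le (by exact_mod_cast Nat.le_succ k)
      cases k with
      | zero => exact i.elim0
      | succ m =>
        refine Fin.cases ?_ (fun j => ?_) i
        · set G := iteratedFDeriv ℝ m f with hG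
          have hGx : ContDiffAt ℝ 2 G x := hf.iteratedFDeriv_right (by norm_cast; omega)
          have hsymm : IsSymmSndFDerivAt ℝ G x := hGx.isSymmSndFDerivAt (by simp)
          have key : ∀ w : Fin (m + 2) → E, iteratedFDeriv ℝ (m + 2) f x w =
              fderiv ℝ (fderiv ℝ G) x (w 0) (w 1) (fun t => w t.succ.succ) := by
            intro w
            have hd : DifferentiableAt ℝ (iteratedFDeriv ℝ (m + 1) f) x :=
              hf.differentiableAt_iteratedFDeriv (by norm_cast; omega)
            have hdG : DifferentiableAt ℝ (fderiv ℝ G) x :=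
              (hGx.fderiv_right (m := 1) (by norm_num)).differentiableAt (by simp)
            have hd1 : DifferentiableAt ℝ (fun y => fderiv ℝ G y (w 1)) x :=
              hdG.clm_apply (differentiableAt_const _)
            rw [iteratedFDeriv_succ_apply_left,
              ← fderiv_continuousMultilinear_apply_const_apply hd]
            have h1 : (fun y => iteratedFDeriv ℝ (m + 1) f y (Fin.tail w)) =
                fun y => fderiv ℝ G y (w 1) (fun t => w t.succ.succ) := by
              funext y
              rw [iteratedFDeriv_succ_apply_left]
              rfl
            rw [h1, fderiv_continuousMultilinear_apply_const_apply hd1,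
              fderiv_clm_apply hdG (differentiableAt_const _)]
            simp
          rw [key, key]
          have h0 : (v ∘ Equiv.swap (Fin.castSucc (0 : Fin (m + 1))) (Fin.succ 0)) 0 = v 1 := by
            simp
          have h1 : (v ∘ Equiv.swap (Fin.castSucc (0 : Fin (m + 1))) (Fin.succ 0)) 1 = v 0 := by
            simp
          have h2 : (fun t : Fin m => (v ∘ Equiv.swap (Fin.castSucc (0 : Fin (m + 1)))
              (Fin.succ 0)) t.succ.succ) = fun t => v t.succ.succ := by
            funext t
            simp only [Function.comp_apply]
            rw [Equiv.swap_apply_of_ne_of_ne]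
            · simp [Fin.ext_iff]
            · simp [Fin.ext_iff]
          rw [h0, h1, h2, hsymm.eq]
        · set τ := Equiv.swap j.castSucc j.succ with hτ
          set w : Fin (m + 1) → E := Fin.tail v with hw
          rw [iteratedFDeriv_succ_apply_left, iteratedFDeriv_succ_apply_left]
          have h0 : (v ∘ Equiv.swap (Fin.castSucc j.succ) j.succ.succ) 0 = v 0 := by
            simp only [Function.comp_apply]
            rw [Equiv.swap_apply_of_ne_of_ne]
            · simp [Fin.ext_iff]
            · simp [Fin.ext_iff]
          have h1 : Fin.tail (v ∘ Equiv.swap (Fin.castSucc j.succ) j.succ.succ) = w ∘ τ := by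
            funext t
            simp only [Fin.tail, Function.comp_apply, hw, hτ, Fin.castSucc_succ]
            congr 1
            exact ((Fin.succ_injective _).swap_apply _ _ _)
          rw [h0, h1]
          have hd : DifferentiableAt ℝ (iteratedFDeriv ℝ (m + 1) f) x :=
            hf.differentiableAt_iteratedFDeriv (by norm_cast; omega)
          rw [← fderiv_continuousMultilinear_apply_const_apply hd,
            ← fderiv_continuousMultilinear_apply_const_apply hd]
          have hev : (fun y => iteratedFDeriv ℝ (m + 1) f y (w ∘ τ)) =ᶠ[𝓝 x]
              fun y => iteratedFDeriv ℝ (m + 1) f y w := by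
            filter_upwards [hf'.eventually (by simp)] with y hy
            exact ih hy τ w
          rw [hev.fderiv_eq]

end Symmetry

/-! ### The spaces `C^r` of the closed ball -/

section Spaces

/-- The Euclidean space `ℝ^n`. -/
abbrev Euc (n : ℕ) : Type := EuclideanSpace ℝ (Fin n)

instance instCompactSpaceClosedBall (n : ℕ) : CompactSpace (closedBall (0 : Euc n) 1) :=
  isCompact_iff_compactSpace.mp (isCompact_closedBall 0 1)

variable (n p r : ℕ) (F : Type u) [NormedAddCommGroup F] [NormedSpace ℝ F]

/-- Families `(g_0, ..., g_r)` where `g_k` is a continuous map from the closed unit ball to the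
`k`-linear maps from `ℝ^n` to `F`, with the norm `∑ k, sup ‖g_k‖`. -/
def DerivFamily : Type u :=
  PiLp 1 (fun k : Fin (r + 1) => C(closedBall (0 : Euc n) 1, (Euc n) [×(k : ℕ)]→L[ℝ] F))

instance DerivFamily.instNormedAddCommGroup : NormedAddCommGroup (DerivFamily n r F) :=
  PiLp.normedAddCommGroup 1
    (fun k : Fin (r + 1) => C(closedBall (0 : Euc n) 1, (Euc n) [×(k : ℕ)]→L[ℝ] F))

instance DerivFamily.instNormedSpace : NormedSpace ℝ (DerivFamily n r F) :=
  PiLp.normedSpace 1 ℝ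
    (fun k : Fin (r + 1) => C(closedBall (0 : Euc n) 1, (Euc n) [×(k : ℕ)]→L[ℝ] F))

variable {n r F} in
/-- The `k`-th member `g_k` of a family `(g_0, ..., g_r)`. -/
def DerivFamily.comp (g : DerivFamily n r F) (k : Fin (r + 1)) :
    C(closedBall (0 : Euc n) 1, (Euc n) [×(k : ℕ)]→L[ℝ] F) :=
  WithLp.ofLp g k

/-- The norm on families is the sum of the supremum norms of their members. -/
theorem DerivFamily.norm_eq_sum (g : DerivFamily n r F) : ‖g‖ = ∑ k, ‖g.comp k‖ :=
  PiLp.norm_eq_of_L1 _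

variable {n r F} in
/-- The function underlying a family `(g_0, ..., g_r)`, i.e. `g_0`, on the closed ball, extended by
zero to `ℝ^n`. -/
def DerivFamily.toFun (g : DerivFamily n r F) (x : Euc n) : F :=
  open Classical in
  if hx : x ∈ closedBall (0 : Euc n) 1 then g.comp 0 ⟨x, hx⟩ (fun _ => 0) else 0

variable {n r F} in
theorem DerivFamily.toFun_add (g h : DerivFamily n r F) :
    (g + h).toFun = g.toFun + h.toFun := by
  funext x
  rw [Pi.add_apply]
  unfold DerivFamily.toFun
  split_ifs with hx
  · rfl
  · exact (add_zero _).symm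

variable {n r F} in
theorem DerivFamily.toFun_smul (c : ℝ) (g : DerivFamily n r F) :
    (c • g).toFun = c • g.toFun := by
  funext x
  rw [Pi.smul_apply]
  unfold DerivFamily.toFun
  split_ifs with hx
  · rfl
  · exact (smul_zero _).symm

theorem DerivFamily.toFun_zero : (0 : DerivFamily n r F).toFun = 0 := by
  funext x
  unfold DerivFamily.toFun
  split_ifs with hx
  · rfl
  · rfl

/-- The Banach space `C^r` of the closed unit ball of `ℝ^n` with values in `F`: maps `f` which are
`C^r` on the open ball, and whose differentials up to order `r` extend continuously to the closed
ball. An element is stored as the family of these (uniquely determined) extensions of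
`f, Df, ..., D^r f`; the norm is the sum of their supremum norms. -/
def CBall : Submodule ℝ (DerivFamily n r F) where
  carrier := {g | ContDiffOn ℝ r g.toFun (ball 0 1) ∧
    ∀ (k : Fin (r + 1)) (x : Euc n) (hx : x ∈ ball (0 : Euc n) 1),
      g.comp k ⟨x, ball_subset_closedBall hx⟩ = iteratedFDeriv ℝ k g.toFun x}
  zero_mem' := by
    have h0 := DerivFamily.toFun_zero n r F
    refine ⟨by rw [h0]; exact contDiffOn_const, fun k x hx => ?_⟩
    rw [h0, iteratedFDeriv_zero]
    rfl
  add_mem' := by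
    rintro g h ⟨hg, hg'⟩ ⟨hh, hh'⟩
    refine ⟨by rw [DerivFamily.toFun_add]; exact hg.add hh, fun k x hx => ?_⟩
    have hk : ((k : ℕ) : WithTop ℕ∞) ≤ r := by exact_mod_cast Nat.lt_succ_iff.mp k.2
    have hn := isOpen_ball.mem_nhds hx
    rw [DerivFamily.toFun_add, iteratedFDeriv_add_apply ((hg.contDiffAt hn).of_le hk)
      ((hh.contDiffAt hn).of_le hk), ← hg' k x hx, ← hh' k x hx]
    rfl
  smul_mem' := by
    rintro c g ⟨hg, hg'⟩
    refine ⟨by rw [DerivFamily.toFun_smul]; exact hg.const_smul c, fun k x hx => ?_⟩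
    have hk : ((k : ℕ) : WithTop ℕ∞) ≤ r := by exact_mod_cast Nat.lt_succ_iff.mp k.2
    have hn := isOpen_ball.mem_nhds hx
    rw [DerivFamily.toFun_smul, iteratedFDeriv_const_smul_apply ((hg.contDiffAt hn).of_le hk),
      ← hg' k x hx]
    rfl

/-! ### Jets -/

/-- Symmetric `k`-linear maps from `ℝ^n` to `F`. -/
def SymMultilinear (k : ℕ) : Submodule ℝ ((Euc n) [×k]→L[ℝ] F) where
  carrier := {m | ∀ (σ : Equiv.Perm (Fin k)) (v : Fin k → Euc n), m (v ∘ σ) = m v}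
  zero_mem' := fun _ _ => rfl
  add_mem' := fun ha hb σ v => by
    simp only [add_apply, ha σ v, hb σ v]
  smul_mem' := fun c _ ha σ v => by
    simp only [smul_apply, ha σ v]

/-- The space `J^p(ℝ^n, F) = ℝ^n × F × L(ℝ^n, F) × ... × L^p_sym(ℝ^n, F)` of `p`-jets of maps from
`ℝ^n` to `F`; it is a Banach space when `F` is. -/
abbrev Jets : Type u := Euc n × (∀ k : Fin (p + 1), SymMultilinear n F (k : ℕ))

/-- The set `J^p(B, F)` of `p`-jets with base point in the closed unit ball `B` of `ℝ^n`. -/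
def jetsOverClosedBall : Set (Jets n p F) := {a | a.1 ∈ closedBall (0 : Euc n) 1}

instance Jets.instNormedAddCommGroup : NormedAddCommGroup (Jets n p F) :=
  Prod.normedAddCommGroup

instance Jets.instNormedSpace : NormedSpace ℝ (Jets n p F) :=
  Prod.normedSpace

variable {n p r F}

/-- The `p`-jet `(x, f(x), Df(x), ..., D^p f(x))` at a point `x` of the open unit ball, of a map
`f` of class `C^r`, `r ≥ p`. -/
def jet (hpr : p ≤ r) (f : CBall n r F) (x : ball (0 : Euc n) 1) : Jets n p F :=
  ((x : Euc n), fun k =>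
    ⟨iteratedFDeriv ℝ (k : ℕ) f.1.toFun (x : Euc n), fun σ v =>
      iteratedFDeriv_symm_of_contDiffAt (k : ℕ)
        ((f.2.1.contDiffAt (isOpen_ball.mem_nhds x.2)).of_le
          (by exact_mod_cast (Nat.lt_succ_iff.mp k.2).trans hpr)) σ v⟩)

end Spaces

end RectJets

end

noncomputable section

namespace RectJets

/-! ### Fredholm operators: products and composition -/

section Fredholm

variable {X Y Z K : Type*} [NormedAddCommGroup X] [NormedSpace ℝ X]
  [NormedAddCommGroup Y] [NormedSpace ℝ Y] [NormedAddCommGroup Z] [NormedSpace ℝ Z]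
  [NormedAddCommGroup K] [NormedSpace ℝ K]

/-! Let `C` be the space of maps of class `C^{p+1}`, `P ⊆ C` the polynomials of degree at most `p`,
and `K` the maps whose derivatives of orders `0, ..., p` vanish at the origin. Taylor expansion at
the origin gives `C = P ⊕ K`, with projection `π` onto `K`. A polynomial in `P` is determined by its
`p`-jet at any point `x`, and this jet is arbitrary, so `f ↦ (jet of f at x, π f)` is bijective for
every `x` in the open ball, with one and the same `π` (`bijective_jetL_taylorRemainder`).

The jet evaluation is `C^1` in `(x, f)` because one derivative is kept in reserve
(`CBall.contDiffOn_evalL`). By the inverse function theorem, `f` is then a `C^1` function `Ψ` of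
`(x, jet, π f)`, and `DΨ` is an isomorphism followed by the projection that forgets `x`: it is
surjective with `n`-dimensional kernel, hence Fredholm of index `n`
(`exists_contDiffAt_inverse_evaluation`).

If `φ(B)` is a piece of `A`, the maps whose jets meet it form the image under `Ψ ∘ (φ × id)` of the
part of `B × K` lying over the open ball. Multiplying by `K` changes neither the index `i` of `φ`
nor the codimension `d + i` of `B`; composing with `Ψ` raises the index to `i + n`. Since `d + i =
(d - n) + (i + n)`, the image has codimension `d - n` (`IsRectifiable.setOf_exists_evaluation_mem`).
-/

open LinearMap.FiniteRangeSetoid in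
theorem isFredholm_prodMap_id {L : Y →L[ℝ] X} (hL : L.IsFredholm) :
    (L.prodMap (ContinuousLinearMap.id ℝ K)).IsFredholm := by
  obtain ⟨v, hvL, hLv⟩ := hL.exists_isQuasiInverse
  -- Both error terms are those of `v` and `L`, padded by zero on `K`, so they keep finite rank.
  refine .of_isQuasiInverse (v := v.prodMap (ContinuousLinearMap.id ℝ K)) ⟨?_, ?_⟩
  · have h := LinearMap.FiniteRangeSetoid.equiv_iff_hasNoetherianRange.mp hvL.equiv
    refine LinearMap.FiniteRangeSetoid.equiv_iff_hasNoetherianRange.mpr ?_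
    have e : (v.prodMap (ContinuousLinearMap.id ℝ K)).toLinearMap ∘ₗ
        (L.prodMap (ContinuousLinearMap.id ℝ K)).toLinearMap - LinearMap.id =
        LinearMap.inl ℝ Y K ∘ₗ (v.toLinearMap ∘ₗ L.toLinearMap - LinearMap.id) ∘ₗ
          LinearMap.fst ℝ Y K := by
      refine LinearMap.ext fun z => Prod.ext ?_ ?_ <;> simp
    exact (congrArg LinearMap.HasNoetherianRange e).mpr
      ((h.comp_right (LinearMap.fst ℝ Y K)).comp_left (LinearMap.inl ℝ Y K))
  · have h := LinearMap.FiniteRangeSetoid.equiv_iff_hasNoetherianRange.mp hLv.equiv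
    refine LinearMap.FiniteRangeSetoid.equiv_iff_hasNoetherianRange.mpr ?_
    have e : (L.prodMap (ContinuousLinearMap.id ℝ K)).toLinearMap ∘ₗ
        (v.prodMap (ContinuousLinearMap.id ℝ K)).toLinearMap - LinearMap.id =
        LinearMap.inl ℝ X K ∘ₗ (L.toLinearMap ∘ₗ v.toLinearMap - LinearMap.id) ∘ₗ
          LinearMap.fst ℝ X K := by
      refine LinearMap.ext fun z => Prod.ext ?_ ?_ <;> simp
    exact (congrArg LinearMap.HasNoetherianRange e).mpr
      ((h.comp_right (LinearMap.fst ℝ X K)).comp_left (LinearMap.inl ℝ X K))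

/-- Strictness comes from the open mapping theorem; the cokernel is zero, and a finite-dimensional
kernel has a closed complement. -/
theorem isFredholm_of_surjective [CompleteSpace X] [CompleteSpace Z] (Q : X →L[ℝ] Z)
    (hQ : Function.Surjective Q) [FiniteDimensional ℝ Q.ker] : Q.IsFredholm where
  isStrictMap := (Q.isOpenMap hQ).isStrictMap Q.continuous
  isClosed_range := by
    rw [LinearMap.range_eq_top.mpr hQ]
    exact isClosed_univ
  finite_ker := inferInstance
  finite_coker := by
    rw [LinearMap.range_eq_top.mpr hQ]
    infer_instance
  closedComplemented_ker := Submodule.ClosedComplemented.of_finiteDimensional _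

theorem isFredholm_comp {Q : X →L[ℝ] Z} {M : Y →L[ℝ] X}
    (hQ : Q.IsFredholm) (hM : M.IsFredholm) : (Q ∘L M).IsFredholm := by
  obtain ⟨q, hq⟩ := hQ.exists_isQuasiInverse
  obtain ⟨m, hm⟩ := hM.exists_isQuasiInverse
  exact .of_isQuasiInverse (v := m ∘L q) (hm.comp hq)

theorem fredholmIndex_prodMap_id (L : Y →L[ℝ] X) :
    fredholmIndex (L.prodMap (ContinuousLinearMap.id ℝ K)) = fredholmIndex L := by
  unfold fredholmIndex
  congr 2
  · refine LinearEquiv.finrank_eq (LinearEquiv.ofLinearMap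
      (((LinearMap.fst ℝ Y K).comp (Submodule.subtype _)).codRestrict _ ?_)
      (((LinearMap.inl ℝ Y K).comp (Submodule.subtype _)).codRestrict _ ?_) ?_ ?_)
    · rintro ⟨z, hz⟩
      exact congrArg Prod.fst (LinearMap.mem_ker.mp hz)
    · rintro ⟨z, hz⟩
      exact Prod.ext hz rfl
    · ext z; rfl
    · refine LinearMap.ext fun z => Subtype.ext (Prod.ext rfl ?_)
      exact (congrArg Prod.snd (LinearMap.mem_ker.mp z.2)).symm
  · set g : X × K →ₗ[ℝ] X ⧸ L.range := L.range.mkQ ∘ₗ LinearMap.fst ℝ X K with hg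
    have hs : Function.Surjective g :=
      (Submodule.mkQ_surjective _).comp LinearMap.fst_surjective
    have hk : (L.prodMap (ContinuousLinearMap.id ℝ K)).range = LinearMap.ker g := by
      ext z
      simp only [LinearMap.mem_range, hg, LinearMap.mem_ker, LinearMap.comp_apply,
        Submodule.mkQ_apply, Submodule.Quotient.mk_eq_zero, LinearMap.fst_apply]
      constructor
      · rintro ⟨y, rfl⟩
        exact ⟨y.1, rfl⟩
      · rintro ⟨y, hy⟩
        exact ⟨(y, z.2), Prod.ext hy rfl⟩
    exact LinearEquiv.finrank_eq
      ((Submodule.quotEquivOfEq _ _ hk).trans (g.quotKerEquivOfSurjective hs))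

/-- Composing a Fredholm operator with a surjective operator with finite-dimensional kernel raises
the index by the dimension of this kernel. -/
theorem fredholmIndex_comp_of_surjective {M : Y →L[ℝ] X} (hM : M.IsFredholm) (Q : X →L[ℝ] Z)
    (hQ : Function.Surjective Q) [FiniteDimensional ℝ Q.ker] :
    fredholmIndex (Q ∘L M) = fredholmIndex M + Module.finrank ℝ Q.ker := by
  -- The count rests on the exact sequence `0 → ker M → ker QM → ker Q → coker M → coker QM → 0`,
  -- whose maps are the inclusion, `m`, `δ` and `q`.
  have hMk := hM.finite_ker
  have hMc : FiniteDimensional ℝ (X ⧸ M.range) := hM.finite_coker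
  -- the connecting map from the kernel of `Q` to the cokernel of `M`
  set δ : Q.ker →ₗ[ℝ] X ⧸ M.range := M.range.mkQ ∘ₗ Q.ker.subtype with hδ
  -- the map induced by `M` on the kernel of the composition
  set m : (Q ∘L M).ker →ₗ[ℝ] Q.ker :=
    (M.toLinearMap ∘ₗ (Q ∘L M).ker.subtype).codRestrict _ (fun z => z.2) with hm
  have hmr : LinearMap.range m = LinearMap.ker δ := by
    ext z
    simp only [LinearMap.mem_range, hδ, LinearMap.mem_ker, LinearMap.comp_apply,
        Submodule.mkQ_apply, Submodule.Quotient.mk_eq_zero, Submodule.subtype_apply]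
    constructor
    · rintro ⟨y, rfl⟩
      exact ⟨y, rfl⟩
    · rintro ⟨y, hy⟩
      refine ⟨⟨y, ?_⟩, Subtype.ext hy⟩
      have h2 : Q z = 0 := z.2
      rw [← hy] at h2
      exact h2
  have hle : M.ker ≤ (Q ∘L M).ker := fun y hy => by
    have : M y = 0 := hy
    simp [this]
  have hmk : Module.finrank ℝ (LinearMap.ker m) = Module.finrank ℝ M.ker := by
    refine LinearEquiv.finrank_eq (LinearEquiv.ofLinearMap
      ((((Q ∘L M).ker.subtype).comp (LinearMap.ker m).subtype).codRestrict _ ?_)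
      ((Submodule.inclusion hle).codRestrict _ ?_) ?_ ?_)
    · rintro ⟨z, hz⟩
      exact congrArg Subtype.val (LinearMap.mem_ker.mp hz)
    · rintro ⟨z, hz⟩
      exact Subtype.ext hz
    · ext z; rfl
    · ext z; rfl
  have hmf : FiniteDimensional ℝ (LinearMap.ker m) := by
    refine FiniteDimensional.of_injective
      ((((Q ∘L M).ker.subtype).comp (LinearMap.ker m).subtype).codRestrict M.ker ?_) ?_
    · rintro ⟨z, hz⟩
      exact congrArg Subtype.val (LinearMap.mem_ker.mp hz)
    · intro a b hab
      exact Subtype.ext (Subtype.ext (congrArg (fun w : M.ker => (w : Y)) hab))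
  -- Rank-nullity for `m` needs a finite-dimensional domain; it is an extension of a subspace of
  -- `ker Q` by a copy of `ker M`.
  have hfin : FiniteDimensional ℝ (Q ∘L M).ker := by
    have := (inferInstance : FiniteDimensional ℝ (LinearMap.range m))
    have := Module.Finite.equiv m.quotKerEquivRange.symm
    exact Module.Finite.of_submodule_quotient (LinearMap.ker m)
  have h1 := LinearMap.finrank_range_add_finrank_ker m
  have h2 := LinearMap.finrank_range_add_finrank_ker δ
  have h3 := Submodule.finrank_quotient_add_finrank (LinearMap.range δ)
  -- the map induced by `Q` on cokernels
  set q : (X ⧸ M.range) →ₗ[ℝ] Z ⧸ (Q ∘L M).range :=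
    M.range.mapQ _ Q.toLinearMap (by rintro _ ⟨y, rfl⟩; exact ⟨y, rfl⟩) with hq
  have hqs : Function.Surjective q := by
    intro z
    obtain ⟨z, rfl⟩ := Submodule.mkQ_surjective _ z
    obtain ⟨x, rfl⟩ := hQ z
    exact ⟨M.range.mkQ x, rfl⟩
  have hqk : LinearMap.ker q = LinearMap.range δ := by
    ext z
    obtain ⟨x, rfl⟩ := Submodule.mkQ_surjective _ z
    simp only [LinearMap.mem_ker, LinearMap.mem_range, hq, hδ, Submodule.mkQ_apply,
      Submodule.mapQ_apply, Submodule.Quotient.mk_eq_zero, LinearMap.comp_apply,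
      Submodule.subtype_apply, Submodule.Quotient.eq]
    constructor
    · rintro ⟨y, hy⟩
      have hy' : Q (M y) = Q x := hy
      refine ⟨⟨x - M y, by simp [hy']⟩, ⟨-y, by simp⟩⟩
    · rintro ⟨⟨w, hw⟩, y, hy⟩
      have hy' : M y = w - x := hy
      have hw' : Q w = 0 := hw
      refine ⟨-y, ?_⟩
      simp [hy', hw']
  have h4 : Module.finrank ℝ ((X ⧸ M.range) ⧸ LinearMap.range δ) =
      Module.finrank ℝ (Z ⧸ (Q ∘L M).range) :=
    LinearEquiv.finrank_eq
      ((Submodule.quotEquivOfEq _ _ hqk.symm).trans (q.quotKerEquivOfSurjective hqs))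
  rw [hmr, hmk] at h1
  unfold fredholmIndex
  omega

end Fredholm

/-! ### Lipschitz graphs in products -/

section LipschitzGraph

variable {Y K : Type*} [NormedAddCommGroup Y] [NormedSpace ℝ Y]
  [NormedAddCommGroup K] [NormedSpace ℝ K]

theorem IsLipschitzGraph.mono {c : ℤ} {B B' : Set Y} (hB : IsLipschitzGraph c B)
    (h : B' ⊆ B) : IsLipschitzGraph c B' := by
  obtain ⟨E, G, hEG, hE, hG, hc, g, hg, hBg⟩ := hB
  exact ⟨E, G, hEG, hE, hG, hc, g, hg, h.trans hBg⟩

/-- The factor `K` is absorbed into the domain of the graph, on which `g` does not depend; the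
complement `G × 0` keeps its dimension. -/
theorem IsLipschitzGraph.prod_univ {c : ℤ} {B : Set Y} (hB : IsLipschitzGraph c B) :
    IsLipschitzGraph c (B ×ˢ (univ : Set K)) := by
  obtain ⟨E, G, hEG, hE, hG, hc, g, ⟨κ, hg⟩, hBg⟩ := hB
  have e : G ≃ₗ[ℝ] (G.prod (⊥ : Submodule ℝ K)) := LinearEquiv.ofLinearMap
    (((LinearMap.inl ℝ Y K).comp G.subtype).codRestrict _ fun z => ⟨z.2, rfl⟩)
    (((LinearMap.fst ℝ Y K).comp (Submodule.subtype _)).codRestrict _ fun z => z.2.1)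
    (LinearMap.ext fun z => Subtype.ext (Prod.ext rfl z.2.2.symm))
    (LinearMap.ext fun z => rfl)
  refine ⟨E.prod ⊤, G.prod ⊥, ?_, ?_, Module.Finite.equiv e, by rw [← e.finrank_eq, hc],
    fun z => ⟨(g ⟨z.1.1, z.2.1⟩, 0), (g ⟨z.1.1, z.2.1⟩).2, rfl⟩, ⟨κ, ?_⟩, ?_⟩
  · refine IsCompl.of_eq ?_ ?_
    · rw [Submodule.prod_inf_prod, hEG.inf_eq_bot, top_inf_eq, Submodule.prod_bot]
    · rw [Submodule.prod_sup_prod, hEG.sup_eq_top, top_sup_eq, Submodule.prod_top]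
  · rw [Submodule.prod_coe]
    exact hE.prod isClosed_univ
  · refine LipschitzWith.of_dist_le_mul fun z w => ?_
    have h1 := hg.dist_le_mul ⟨z.1.1, z.2.1⟩ ⟨w.1.1, w.2.1⟩
    rw [Subtype.dist_eq, Subtype.dist_eq] at h1
    rw [Subtype.dist_eq, Subtype.dist_eq, Prod.dist_eq, Prod.dist_eq, dist_self]
    refine max_le (h1.trans ?_) (by positivity)
    gcongr
    exact le_max_left _ _
  · rintro ⟨y, k⟩ ⟨hy, -⟩
    obtain ⟨x, hx⟩ := hBg hy
    exact ⟨⟨(x, k), x.2, trivial⟩, Prod.ext hx (add_zero k).symm⟩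

end LipschitzGraph

/-! ### Rectifiable sets and families of evaluations -/

section Evaluation

variable {V : Type} [NormedAddCommGroup V] [NormedSpace ℝ V] [FiniteDimensional ℝ V]
  {J C K : Type u} [NormedAddCommGroup J] [NormedSpace ℝ J] [CompleteSpace J]
  [NormedAddCommGroup C] [NormedSpace ℝ C] [CompleteSpace C]
  [NormedAddCommGroup K] [NormedSpace ℝ K] [CompleteSpace K]

/-- Let `(x, f) ↦ ev (x, f)` be `C^1` on `Ω × C` and linear in `f`. If for all `x ∈ Ω` the pair
`(ev (x, ·), π)` is a bijection, then `f` is a `C^1` function of `(x, ev (x, f), π f)`, and the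
differential of this function is surjective, with kernel of dimension `dim V`. -/
theorem exists_contDiffAt_inverse_evaluation {Ω : Set V} (hΩ : IsOpen Ω) {ev : V × C → J}
    (hev : ContDiffOn ℝ 1 ev (Ω ×ˢ univ)) (T : V → C →L[ℝ] J) (π : C →L[ℝ] K)
    (hT : ∀ x ∈ Ω, ∀ f, ev (x, f) = T x f)
    (hbij : ∀ x ∈ Ω, Function.Bijective fun f => (T x f, π f)) :
    ∃ Ψ : (V × J) × K → C,
      (∀ z, z.1.1 ∈ Ω → ev (z.1.1, Ψ z) = z.1.2) ∧
      (∀ x ∈ Ω, ∀ f, Ψ ((x, ev (x, f)), π f) = f) ∧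
      ∀ z, z.1.1 ∈ Ω → ContDiffAt ℝ 1 Ψ z ∧ Function.Surjective (fderiv ℝ Ψ z) ∧
        FiniteDimensional ℝ (fderiv ℝ Ψ z).ker ∧
        Module.finrank ℝ (fderiv ℝ Ψ z).ker = Module.finrank ℝ V := by
  classical
  have : CompleteSpace V := FiniteDimensional.complete ℝ V
  have hex : ∀ z : (V × J) × K, ∃ f, z.1.1 ∈ Ω → T z.1.1 f = z.1.2 ∧ π f = z.2 := fun z => by
    by_cases hz : z.1.1 ∈ Ω
    · obtain ⟨f, hf⟩ := (hbij _ hz).2 (z.1.2, z.2)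
      exact ⟨f, fun _ => ⟨congrArg Prod.fst hf, congrArg Prod.snd hf⟩⟩
    -- Outside `Ω` the value of `Ψ` is irrelevant.
    · exact ⟨0, fun h => absurd h hz⟩
  choose Ψ hΨ using hex
  have hΨl : ∀ x ∈ Ω, ∀ f, Ψ ((x, ev (x, f)), π f) = f := fun x hx f => by
    obtain ⟨h1, h2⟩ := hΨ ((x, ev (x, f)), π f) hx
    refine (hbij x hx).1 (Prod.ext ?_ h2)
    exact h1.trans (hT x hx f)
  refine ⟨Ψ, fun z hz => (hT _ hz _).trans (hΨ z hz).1, hΨl, fun z hz => ?_⟩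
  set a : V × C := (z.1.1, Ψ z) with ha
  set G : V × C → (V × J) × K := fun w => ((w.1, ev w), π w.2) with hG
  have hGa : G a = z := Prod.ext (Prod.ext rfl ((hT _ hz _).trans (hΨ z hz).1)) (hΨ z hz).2
  have hopen : Ω ×ˢ (univ : Set C) ∈ 𝓝 a := (hΩ.prod isOpen_univ).mem_nhds ⟨hz, trivial⟩
  have heva : ContDiffAt ℝ 1 ev a := hev.contDiffAt hopen
  have hGc : ContDiffAt ℝ 1 G a :=
    (contDiffAt_fst.prodMk heva).prodMk (π.contDiff.contDiffAt.comp a contDiffAt_snd)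
  set D := fderiv ℝ ev a with hD
  have hDev : HasFDerivAt ev D a := (heva.differentiableAt one_ne_zero).hasFDerivAt
  set G' : V × C →L[ℝ] (V × J) × K :=
    ((ContinuousLinearMap.fst ℝ V C).prod D).prod (π ∘L ContinuousLinearMap.snd ℝ V C) with hG'
  have hGd : HasFDerivAt G G' a :=
    (hasFDerivAt_fst.prodMk hDev).prodMk (π.hasFDerivAt.comp a hasFDerivAt_snd)
  -- the partial differential in the second variable
  have hDT : ∀ g, D (0, g) = T z.1.1 g := fun g => by
    have h1 : HasFDerivAt (fun f : C => ev (z.1.1, f)) (D ∘L ContinuousLinearMap.inr ℝ V C) (Ψ z) :=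
      HasFDerivAt.comp (Ψ z) hDev (hasFDerivAt_prodMk_right z.1.1 (Ψ z))
    have h2 : (fun f : C => ev (z.1.1, f)) = T z.1.1 := funext fun f => hT _ hz f
    rw [h2] at h1
    exact congrArg (fun L => L g) (h1.unique (T z.1.1).hasFDerivAt)
  have hDs : ∀ v g, D (v, g) = D (v, 0) + T z.1.1 g := fun v g => by
    rw [← hDT, ← map_add]; simp
  -- `G'` is block triangular: the identity on `V`, and the bijection `(T x, π)` on `C`.
  have hG'i : LinearMap.ker G'.toLinearMap = ⊥ := by
    refine LinearMap.ker_eq_bot'.mpr fun w hw => ?_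
    obtain ⟨v, g⟩ := w
    have hv : v = 0 := congrArg (fun t => t.1.1) hw
    subst hv
    have h1 : D (0, g) = 0 := congrArg (fun t => t.1.2) hw
    have h2 : π g = 0 := congrArg Prod.snd hw
    rw [hDT] at h1
    refine Prod.ext rfl ((hbij _ hz).1 (Prod.ext ?_ ?_))
    · exact h1.trans (map_zero _).symm
    · exact h2.trans (map_zero _).symm
  have hG's : LinearMap.range G'.toLinearMap = ⊤ := by
    refine LinearMap.range_eq_top.mpr fun w => ?_
    obtain ⟨⟨v, b⟩, k⟩ := w
    obtain ⟨g, hg⟩ := (hbij _ hz).2 (b - D (v, 0), k)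
    have h2 : π g = k := congrArg Prod.snd hg
    refine ⟨(v, g), Prod.ext (Prod.ext rfl ?_) h2⟩
    have h1 : T z.1.1 g = b - D (v, 0) := congrArg Prod.fst hg
    change D (v, g) = b
    rw [hDs, h1]; abel
  set e := ContinuousLinearEquiv.ofBijective G' hG'i hG's with he
  have heG : (e : V × C →L[ℝ] (V × J) × K) = G' := ContinuousLinearEquiv.coe_ofBijective _ _ _
  have hGe : HasFDerivAt G (e : V × C →L[ℝ] (V × J) × K) a := heG ▸ hGd
  have hGstrict : HasStrictFDerivAt G (e : V × C →L[ℝ] (V × J) × K) a :=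
    hGc.hasStrictFDerivAt' hGe one_ne_zero
  set H : (V × J) × K → V × C := fun w => (w.1.1, Ψ w) with hH
  have hHG : ∀ᶠ w in 𝓝 a, H (G w) = w := by
    -- A left inverse of `G` near `a` must agree with the local inverse of the inverse function
    -- theorem, so `H` inherits its regularity.
    filter_upwards [hopen] with w hw
    exact Prod.ext rfl (hΨl w.1 hw.1 w.2)
  have hHloc : ∀ᶠ w in 𝓝 (G a), H w = hGstrict.localInverse G e a w :=
    hGstrict.localInverse_unique hHG
  have hHc : ContDiffAt ℝ 1 H z := by
    rw [← hGa]
    exact (hGc.to_localInverse hGe one_ne_zero).congr_of_eventuallyEq hHloc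
  have hHd : HasFDerivAt H (e.symm : (V × J) × K →L[ℝ] V × C) z := by
    rw [← hGa]
    exact (hGstrict.to_local_left_inverse hHG).hasFDerivAt
  have hΨd : fderiv ℝ Ψ z = ContinuousLinearMap.snd ℝ V C ∘L
      (e.symm : (V × J) × K →L[ℝ] V × C) :=
    (HasFDerivAt.comp (g := Prod.snd) z hasFDerivAt_snd hHd).fderiv
  have hker : (fderiv ℝ Ψ z).ker =
      LinearMap.range (e.toLinearEquiv.toLinearMap ∘ₗ LinearMap.inl ℝ V C) := by
    ext w
    rw [hΨd]
    constructor
    · intro hw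
      have hw' : (e.symm w).2 = 0 := hw
      refine ⟨(e.symm w).1, ?_⟩
      change e ((e.symm w).1, 0) = w
      rw [← hw', Prod.mk.eta, e.apply_symm_apply]
    · rintro ⟨v, rfl⟩
      change (e.symm (e (v, 0))).2 = 0
      rw [e.symm_apply_apply]
  refine ⟨contDiffAt_snd.comp z hHc, ?_, ?_, ?_⟩
  · rw [hΨd]
    exact fun f => ⟨e (0, f), by simp⟩
  · rw [hker]; infer_instance
  · rw [hker]
    exact LinearMap.finrank_range_of_inj (e.injective.comp LinearMap.inl_injective)

/-- Each piece `φ(B)` is pulled back to `V × C` in the coordinates `(x, ev (x, f), π f)`, where it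
becomes `φ(B) × K`, and then projected to `C` by `Ψ`. -/
theorem IsRectifiable.setOf_exists_evaluation_mem
    [TopologicalSpace.SeparableSpace K] {Ω : Set V} (hΩ : IsOpen Ω) {ev : V × C → J}
    (hev : ContDiffOn ℝ 1 ev (Ω ×ˢ univ)) (T : V → C →L[ℝ] J) (π : C →L[ℝ] K)
    (hT : ∀ x ∈ Ω, ∀ f, ev (x, f) = T x f)
    (hbij : ∀ x ∈ Ω, Function.Bijective fun f => (T x f, π f))
    {d : ℕ} (hd : Module.finrank ℝ V ≤ d) {A : Set (V × J)} (hA : IsRectifiable d A) :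
    IsRectifiable (d - Module.finrank ℝ V) {f : C | ∃ x ∈ Ω, (x, ev (x, f)) ∈ A} := by
  obtain ⟨𝒮, h𝒮, hS, rfl⟩ := hA
  refine ⟨(fun S => {f : C | ∃ x ∈ Ω, (x, ev (x, f)) ∈ S}) '' 𝒮, h𝒮.image _, ?_, ?_⟩
  swap
  · ext f
    simp only [mem_ofPred_eq, mem_sUnion, sUnion_image, mem_iUnion]
    constructor
    · rintro ⟨x, hx, S, hSm, hxS⟩; exact ⟨S, hSm, x, hx, hxS⟩
    · rintro ⟨S, hSm, x, hx, hxS⟩; exact ⟨x, hx, S, hSm, hxS⟩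
  rintro _ ⟨S, hSm, rfl⟩
  obtain ⟨Y, _, _, _, _, U, φ, i, B, ⟨hU, hφ, hfr⟩, hBU, hB, rfl⟩ := hS S hSm
  obtain ⟨Ψ, hΨ1, hΨ2, hΨ3⟩ := exists_contDiffAt_inverse_evaluation hΩ hev T π hT hbij
  -- Points of `A` may lie over the complement of `Ω`, where `Ψ` is not controlled; they are
  -- discarded.
  set U' : Set (Y × K) := (U ∩ (fun y => (φ y).1) ⁻¹' Ω) ×ˢ univ with hU'
  have hU'o : IsOpen U' :=
    ((continuous_fst.comp_continuousOn hφ.continuousOn).isOpen_inter_preimage hU hΩ).prod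
      isOpen_univ
  set φK : Y × K → (V × J) × K := Prod.map φ id with hφK
  have hφc : ∀ w ∈ U', ContDiffAt ℝ 1 φK w := fun w hw =>
    ((hφ.contDiffAt (hU.mem_nhds hw.1.1)).comp w contDiffAt_fst).prodMk contDiffAt_snd
  have hφd : ∀ w ∈ U', HasFDerivAt φK
      ((fderiv ℝ φ w.1).prodMap (ContinuousLinearMap.id ℝ K)) w := fun w hw =>
    HasFDerivAt.prodMap w (((hφ.contDiffAt (hU.mem_nhds hw.1.1)).differentiableAt
      one_ne_zero).hasFDerivAt) (hasFDerivAt_id _)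
  refine ⟨Y × K, inferInstance, inferInstance, inferInstance, inferInstance, U', Ψ ∘ φK,
    i + Module.finrank ℝ V, (B ∩ (fun y => (φ y).1) ⁻¹' Ω) ×ˢ univ, ⟨hU'o, ?_, ?_⟩, ?_, ?_, ?_⟩
  · exact fun w hw => ((hΨ3 (φK w) hw.1.2).1.comp w (hφc w hw)).contDiffWithinAt
  · intro w hw
    obtain ⟨hc, hs, hf, hr⟩ := hΨ3 (φK w) hw.1.2
    have hfd : fderiv ℝ (Ψ ∘ φK) w = fderiv ℝ Ψ (φK w) ∘L
        (fderiv ℝ φ w.1).prodMap (ContinuousLinearMap.id ℝ K) :=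
      ((hc.differentiableAt one_ne_zero).hasFDerivAt.comp w (hφd w hw)).fderiv
    have hM := isFredholm_prodMap_id (K := K) (hfr w.1 hw.1.1).1
    rw [hfd]
    refine ⟨?_, ?_⟩
    · exact isFredholm_comp (isFredholm_of_surjective _ hs) hM
    · rw [fredholmIndex_comp_of_surjective hM _ hs, fredholmIndex_prodMap_id,
        (hfr w.1 hw.1.1).2, hr]
  · exact prod_mono (inter_subset_inter_left _ hBU) subset_rfl
  -- The subtraction of natural numbers is not truncated, by `hd`.
  · have h1 : (((d - Module.finrank ℝ V : ℕ) : ℤ) + (i + Module.finrank ℝ V)) = d + i := by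
      push_cast [Nat.cast_sub hd]; ring
    rw [h1]
    exact hB.prod_univ.mono (prod_mono inter_subset_left subset_rfl)
  · ext f
    simp only [mem_ofPred_eq, mem_image]
    constructor
    · rintro ⟨x, hx, y, hy, hxy⟩
      have hx' : (φ y).1 = x := congrArg Prod.fst hxy
      refine ⟨(y, π f), ⟨⟨hy, ?_⟩, trivial⟩, ?_⟩
      · change (φ y).1 ∈ Ω
        rwa [hx']
      · change Ψ (φ y, π f) = f
        rw [hxy, hΨ2 x hx]
    · rintro ⟨w, hw, rfl⟩
      refine ⟨(φ w.1).1, hw.1.2, w.1, hw.1.1, ?_⟩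
      exact Prod.ext rfl (hΨ1 (φK w) hw.1.2).symm

end Evaluation

/-! ### The Banach space `C^r` of the closed ball -/

section BallSpace

variable {n r : ℕ} {F : Type u} [NormedAddCommGroup F] [NormedSpace ℝ F]

variable (n r F) in
/-- The projection of a family `(g_0, ..., g_r)` to its `k`-th member. -/
def DerivFamily.compL (k : Fin (r + 1)) :
    DerivFamily n r F →L[ℝ] C(closedBall (0 : Euc n) 1, (Euc n) [×(k : ℕ)]→L[ℝ] F) :=
  PiLp.proj 1 (𝕜 := ℝ)
    (fun k : Fin (r + 1) => C(closedBall (0 : Euc n) 1, (Euc n) [×(k : ℕ)]→L[ℝ] F)) k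

theorem DerivFamily.ext {g h : DerivFamily n r F} (H : ∀ k, g.comp k = h.comp k) : g = h :=
  PiLp.ext H

theorem DerivFamily.norm_comp_le (g : DerivFamily n r F) (k : Fin (r + 1)) : ‖g.comp k‖ ≤ ‖g‖ := by
  rw [DerivFamily.norm_eq_sum]
  exact Finset.single_le_sum (f := fun k => ‖g.comp k‖) (fun k _ => norm_nonneg (g.comp k))
    (Finset.mem_univ k)

open Classical in
variable (n r F) in
/-- Evaluation at `x` of the `k`-th member of a family, extended by zero outside the closed ball. -/
def DerivFamily.evalL (k : Fin (r + 1)) (x : Euc n) :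
    DerivFamily n r F →L[ℝ] (Euc n) [×(k : ℕ)]→L[ℝ] F :=
  if hx : x ∈ closedBall (0 : Euc n) 1 then
    (ContinuousMap.evalCLM ℝ (⟨x, hx⟩ : closedBall (0 : Euc n) 1)).comp (DerivFamily.compL n r F k)
  else 0

theorem DerivFamily.evalL_apply (k : Fin (r + 1)) {x : Euc n} (hx : x ∈ closedBall (0 : Euc n) 1)
    (g : DerivFamily n r F) : DerivFamily.evalL n r F k x g = g.comp k ⟨x, hx⟩ := by
  rw [DerivFamily.evalL, dif_pos hx]
  rfl

theorem DerivFamily.norm_evalL_apply_le (k : Fin (r + 1)) (x : Euc n) (g : DerivFamily n r F) :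
    ‖DerivFamily.evalL n r F k x g‖ ≤ ‖g‖ := by
  by_cases hx : x ∈ closedBall (0 : Euc n) 1
  · rw [DerivFamily.evalL_apply k hx]
    exact ((g.comp k).norm_coe_le_norm _).trans (g.norm_comp_le k)
  · rw [DerivFamily.evalL, dif_neg hx]
    simp

theorem DerivFamily.toFun_eq {g : DerivFamily n r F} {x : Euc n}
    (hx : x ∈ closedBall (0 : Euc n) 1) : g.toFun x = g.comp 0 ⟨x, hx⟩ (fun _ => 0) := by
  rw [DerivFamily.toFun, dif_pos hx]

theorem DerivFamily.continuousOn_evalL (k : Fin (r + 1)) :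
    ContinuousOn (fun z : Euc n × DerivFamily n r F => DerivFamily.evalL n r F k z.1 z.2)
      (closedBall 0 1 ×ˢ univ) := by
  rw [continuousOn_iff_continuous_domRestrict]
  have h : Continuous fun z : (closedBall (0 : Euc n) 1 ×ˢ univ : Set (Euc n × DerivFamily n r F)) =>
      (DerivFamily.compL n r F k z.1.2) ⟨z.1.1, z.2.1⟩ :=
    ((DerivFamily.compL n r F k).continuous.comp
      (continuous_snd.comp continuous_subtype_val)).eval
      ((continuous_fst.comp continuous_subtype_val).subtype_mk _)
  convert h using 1
  ext1 z
  exact DerivFamily.evalL_apply k z.2.1 z.1.2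

/-- A family belongs to `C^r` of the closed ball if and only if each of its members has the next
one as its differential on the open ball. -/
theorem mem_CBall_iff {g : DerivFamily n r F} :
    g ∈ CBall n r F ↔ ∀ (k : ℕ) (hk : k < r), ∀ x ∈ ball (0 : Euc n) 1,
      HasFDerivAt (fun y => DerivFamily.evalL n r F ⟨k, by omega⟩ y g)
        (DerivFamily.evalL n r F ⟨k + 1, by omega⟩ x g).curryLeft x := by
  constructor
  · rintro ⟨hg, hg'⟩ k hk x hx
    have hev : (fun y => DerivFamily.evalL n r F ⟨k, by omega⟩ y g) =ᶠ[𝓝 x]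
        iteratedFDeriv ℝ k g.toFun := by
      filter_upwards [isOpen_ball.mem_nhds hx] with y hy
      rw [DerivFamily.evalL_apply _ (ball_subset_closedBall hy)]
      exact hg' ⟨k, by omega⟩ y hy
    have hd : DifferentiableAt ℝ (iteratedFDeriv ℝ k g.toFun) x :=
      (hg.contDiffAt (isOpen_ball.mem_nhds hx)).differentiableAt_iteratedFDeriv
        (by exact_mod_cast hk)
    refine HasFDerivAt.congr_of_eventuallyEq ?_ hev
    have h1 : DerivFamily.evalL n r F ⟨k + 1, by omega⟩ x g =
        iteratedFDeriv ℝ (k + 1) g.toFun x := by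
      rw [DerivFamily.evalL_apply _ (ball_subset_closedBall hx)]
      exact hg' ⟨k + 1, by omega⟩ x hx
    rw [h1]
    exact hd.hasFDerivAt
  · intro H
    -- The members of `g` form a Taylor series up to order `r`; orders above `r` are padded by zero.
    -- Uniqueness of derivatives on an open set then identifies them with those of `g.toFun`.
    set P : Euc n → FormalMultilinearSeries ℝ (Euc n) F := fun x k =>
      if h : k < r + 1 then DerivFamily.evalL n r F ⟨k, h⟩ x g else 0 with hP
    have hPk : ∀ (k : ℕ) (hk : k < r + 1),
        (P · k) = fun x => DerivFamily.evalL n r F ⟨k, hk⟩ x g := fun k hk => by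
      funext x
      simp only [hP, dif_pos hk]
    have hT : HasFTaylorSeriesUpToOn (r : ℕ∞) g.toFun P (ball 0 1) := by
      refine ⟨fun x hx => ?_, fun m hm x hx => ?_, fun m hm => ?_⟩
      · have hx' := ball_subset_closedBall hx
        rw [DerivFamily.toFun_eq hx', congrFun (hPk 0 (by omega)) x, DerivFamily.evalL_apply _ hx',
          ContinuousMultilinearMap.curry0]
        exact congrArg _ (Subsingleton.elim _ _)
      · have hm' : m < r := by exact_mod_cast hm
        rw [hPk m (by omega), congrFun (hPk (m + 1) (by omega)) x]
        exact (H m hm' x hx).hasFDerivWithinAt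
      · have hm' : m < r + 1 := by
          have : m ≤ r := by exact_mod_cast hm
          omega
        rw [hPk m hm']
        exact (DerivFamily.continuousOn_evalL ⟨m, hm'⟩).comp (t := closedBall 0 1 ×ˢ univ)
          (f := fun x => (x, g)) (by fun_prop) fun x hx => ⟨ball_subset_closedBall hx, trivial⟩
    refine ⟨hT.contDiffOn, fun k x hx => ?_⟩
    have hk : (((k : ℕ) : ℕ∞) : WithTop ℕ∞) ≤ ((r : ℕ∞) : WithTop ℕ∞) := by
      exact_mod_cast Nat.lt_succ_iff.mp k.2
    have h1 := hT.eq_iteratedFDerivWithin_of_uniqueDiffOn hk isOpen_ball.uniqueDiffOn hx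
    rw [iteratedFDerivWithin_of_isOpen _ isOpen_ball hx] at h1
    rw [← h1, congrFun (hPk k k.2) x, DerivFamily.evalL_apply]

instance instCompleteSpaceDerivFamily [CompleteSpace F] :
    CompleteSpace (DerivFamily n r F) :=
  inferInstanceAs (CompleteSpace (PiLp 1 (fun k : Fin (r + 1) =>
    C(closedBall (0 : Euc n) 1, (Euc n) [×(k : ℕ)]→L[ℝ] F))))

/-- Convergence in norm is uniform in every order, and a uniform limit of derivatives is the
derivative of the limit, so the criterion `mem_CBall_iff` passes to limits. -/
theorem isClosed_CBall : IsClosed (CBall n r F : Set (DerivFamily n r F)) := by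
  refine IsSeqClosed.isClosed fun g g₀ hg hlim => ?_
  refine mem_CBall_iff.mpr fun k hk x hx => ?_
  have key : ∀ j : Fin (r + 1), TendstoUniformlyOn (fun m y => DerivFamily.evalL n r F j y (g m))
      (fun y => DerivFamily.evalL n r F j y g₀) Filter.atTop (ball 0 1) := fun j => by
    refine Metric.tendstoUniformlyOn_iff.mpr fun ε hε => ?_
    filter_upwards [(Metric.tendsto_nhds.mp hlim) ε hε] with m hm y _
    rw [dist_comm, dist_eq_norm, ← map_sub]
    refine (DerivFamily.norm_evalL_apply_le j y _).trans_lt ?_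
    rwa [← dist_eq_norm]
  have hcurry := (continuousMultilinearCurryLeftEquiv ℝ
    (fun _ : Fin (k + 1) => Euc n) F).isometry.uniformContinuous.comp_tendstoUniformlyOn
    (key ⟨k + 1, by omega⟩)
  refine hasFDerivAt_of_tendstoUniformlyOn isOpen_ball hcurry
    (fun m y hy => mem_CBall_iff.mp (hg m) k hk y hy)
    (fun y hy => (key ⟨k, by omega⟩).tendsto_at hy) hx

instance instCompleteSpaceCBall [CompleteSpace F] : CompleteSpace (CBall n r F) :=
  isClosed_CBall.completeSpace_coe

theorem secondCountableTopology_continuousMultilinearMap (E : Type*) [NormedAddCommGroup E]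
    [NormedSpace ℝ E] [FiniteDimensional ℝ E] [SecondCountableTopology F] (k : ℕ) :
    SecondCountableTopology (E [×k]→L[ℝ] F) := by
  induction k with
  | zero =>
    exact (continuousMultilinearCurryFin0 ℝ E F).toHomeomorph.secondCountableTopology
  | succ k ih =>
    exact (continuousMultilinearCurryLeftEquiv ℝ
      (fun _ : Fin (k + 1) => E) F).toHomeomorph.secondCountableTopology

instance instSeparableSpaceCBall [TopologicalSpace.SeparableSpace F] :
    TopologicalSpace.SeparableSpace (CBall n r F) := by
  have : SecondCountableTopology F := UniformSpace.secondCountable_of_separable F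
  have (k : ℕ) : SecondCountableTopology ((Euc n) [×k]→L[ℝ] F) :=
    secondCountableTopology_continuousMultilinearMap (Euc n) k
  -- Second countability, unlike separability in general, passes to subspaces.
  have : SecondCountableTopology (DerivFamily n r F) :=
    inferInstanceAs (SecondCountableTopology (PiLp 1 (fun k : Fin (r + 1) =>
      C(closedBall (0 : Euc n) 1, (Euc n) [×(k : ℕ)]→L[ℝ] F))))
  infer_instance

end BallSpace

/-! ### Differentiability of the evaluation of derivatives -/

section EvaluationMap

variable {n r : ℕ} {F : Type u} [NormedAddCommGroup F] [NormedSpace ℝ F]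

variable (n r F) in
/-- The `k`-th differential at the point `x` of the closed ball, as a linear function of the map. -/
def CBall.evalL (k : Fin (r + 1)) (x : Euc n) : CBall n r F →L[ℝ] (Euc n) [×(k : ℕ)]→L[ℝ] F :=
  (DerivFamily.evalL n r F k x).comp (CBall n r F).subtypeL

theorem CBall.evalL_apply (k : Fin (r + 1)) (x : Euc n) (f : CBall n r F) :
    CBall.evalL n r F k x f = DerivFamily.evalL n r F k x f.1 := rfl

theorem CBall.evalL_eq_iteratedFDeriv (k : Fin (r + 1)) {x : Euc n} (hx : x ∈ ball (0 : Euc n) 1)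
    (f : CBall n r F) : CBall.evalL n r F k x f = iteratedFDeriv ℝ k f.1.toFun x := by
  rw [CBall.evalL_apply, DerivFamily.evalL_apply k (ball_subset_closedBall hx)]
  exact f.2.2 k x hx

theorem CBall.hasFDerivAt_evalL {k : ℕ} (hk : k < r) {x : Euc n} (hx : x ∈ ball (0 : Euc n) 1)
    (f : CBall n r F) :
    HasFDerivAt (fun y => CBall.evalL n r F ⟨k, by omega⟩ y f)
      (CBall.evalL n r F ⟨k + 1, by omega⟩ x f).curryLeft x :=
  mem_CBall_iff.mp f.2 k hk x hx

/-- Mean value inequality on the convex ball: the norm of `f` bounds its derivative of order `k +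
1`. The reserve `k < r` yields continuity in operator norm, uniformly in `f`. -/
theorem CBall.norm_evalL_sub_le {k : ℕ} (hk : k < r) {x y : Euc n}
    (hx : x ∈ ball (0 : Euc n) 1) (hy : y ∈ ball (0 : Euc n) 1) :
    ‖CBall.evalL n r F ⟨k, Nat.lt_succ_of_lt hk⟩ y - CBall.evalL n r F ⟨k, Nat.lt_succ_of_lt hk⟩ x‖ ≤ ‖y - x‖ := by
  refine ContinuousLinearMap.opNorm_le_bound _ (norm_nonneg _) fun f => ?_
  rw [mul_comm]
  refine (convex_ball (0 : Euc n) 1).norm_image_sub_le_of_norm_hasFDerivWithin_le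
    (fun z hz => (CBall.hasFDerivAt_evalL hk hz f).hasFDerivWithinAt) (fun z _ => ?_) hx hy
  rw [ContinuousMultilinearMap.curryLeft_norm]
  exact DerivFamily.norm_evalL_apply_le _ _ _

/-- The top order `k = r` is included: operator-norm continuity in `x` may fail there, but joint
continuity suffices for the partial differential in `x`. -/
theorem CBall.continuousOn_evalL_uncurry (k : Fin (r + 1)) :
    ContinuousOn (fun z : Euc n × CBall n r F => CBall.evalL n r F k z.1 z.2)
      (closedBall 0 1 ×ˢ univ) :=
  (DerivFamily.continuousOn_evalL k).comp (t := closedBall 0 1 ×ˢ univ)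
    (f := fun z : Euc n × CBall n r F => (z.1, z.2.1))
    (continuous_fst.prodMk (continuous_subtype_val.comp continuous_snd)).continuousOn fun _ hz => ⟨hz.1, trivial⟩

theorem CBall.continuousOn_evalL {k : ℕ} (hk : k < r) :
    ContinuousOn (CBall.evalL n r F ⟨k, by omega⟩) (ball 0 1) := by
  have h : LipschitzOnWith 1 (CBall.evalL n r F ⟨k, by omega⟩) (ball 0 1) :=
    LipschitzOnWith.of_dist_le_mul fun y hy x hx => by
      rw [dist_eq_norm, dist_eq_norm, NNReal.coe_one, one_mul]
      exact CBall.norm_evalL_sub_le hk hx hy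
  exact h.continuousOn

/-- The evaluation `(x, f) ↦ D^k f(x)` is `C^1` on the space of maps of class `C^r`, for `k < r`. -/
theorem CBall.contDiffOn_evalL {k : ℕ} (hk : k < r) :
    ContDiffOn ℝ 1 (fun z : Euc n × CBall n r F => CBall.evalL n r F ⟨k, by omega⟩ z.1 z.2)
      (ball 0 1 ×ˢ univ) := by
  have hopen : IsOpen (ball (0 : Euc n) 1 ×ˢ (univ : Set (CBall n r F))) :=
    isOpen_ball.prod isOpen_univ
  rw [show (1 : WithTop ℕ∞) = 0 + 1 from (zero_add 1).symm,
    contDiffOn_succ_iff_hasFDerivWithinAt_of_uniqueDiffOn hopen.uniqueDiffOn]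
  refine ⟨fun h => absurd h (by simp), fun z =>
    (CBall.evalL n r F ⟨k + 1, by omega⟩ z.1 z.2).curryLeft ∘L ContinuousLinearMap.fst ℝ _ _ +
      CBall.evalL n r F ⟨k, by omega⟩ z.1 ∘L ContinuousLinearMap.snd ℝ _ _, ?_, ?_⟩
  · refine contDiffOn_zero.mpr (ContinuousOn.add ?_ ?_)
    · refine ContinuousOn.clm_comp ?_ continuousOn_const
      exact (continuousMultilinearCurryLeftEquiv ℝ
        (fun _ : Fin (k + 1) => Euc n) F).continuous.comp_continuousOn
        ((CBall.continuousOn_evalL_uncurry ⟨k + 1, by omega⟩).mono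
          (prod_mono ball_subset_closedBall subset_rfl))
    · refine ContinuousOn.clm_comp ?_ continuousOn_const
      exact (CBall.continuousOn_evalL hk).comp continuousOn_fst fun z hz => hz.1
  · rintro ⟨x, f⟩ ⟨hx, -⟩
    refine HasFDerivAt.hasFDerivWithinAt ?_
    set ev : Euc n → CBall n r F →L[ℝ] _ := CBall.evalL n r F ⟨k, by omega⟩ with hev
    have h1 : HasFDerivAt (fun z : Euc n × CBall n r F => ev z.1 f)
        ((CBall.evalL n r F ⟨k + 1, by omega⟩ x f).curryLeft ∘L ContinuousLinearMap.fst ℝ _ _)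
        (x, f) :=
      HasFDerivAt.comp (g := fun y => ev y f) (x, f) (CBall.hasFDerivAt_evalL hk hx f)
        hasFDerivAt_fst
    have h2 : HasFDerivAt (fun z : Euc n × CBall n r F => ev x (z.2 - f))
        (ev x ∘L ContinuousLinearMap.snd ℝ _ _) (x, f) :=
      (ev x).hasFDerivAt.comp (x, f) (hasFDerivAt_snd.sub_const f)
    -- The evaluation at `z` splits as `ev z.1 f + ev x (z.2 - f)` plus this cross term, which is
    -- quadratically small by the Lipschitz bound.
    have h3 : HasFDerivAt (fun z : Euc n × CBall n r F => (ev z.1 - ev x) (z.2 - f))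
        (0 : Euc n × CBall n r F →L[ℝ] _) (x, f) := by
      refine Asymptotics.IsBigO.hasFDerivAt (n := 2) ?_ one_lt_two
      refine Asymptotics.IsBigO.of_bound 1 ?_
      filter_upwards [hopen.mem_nhds (mk_mem_prod hx (mem_univ f))] with z hz
      rw [one_mul, norm_pow, norm_norm, pow_two]
      refine (ContinuousLinearMap.le_opNorm _ _).trans ?_
      gcongr
      · exact (CBall.norm_evalL_sub_le hk hx hz.1).trans (norm_fst_le (z - (x, f)))
      · exact norm_snd_le (z - (x, f))
    have h := (h1.add h2).add h3
    rw [add_zero] at h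
    refine h.congr_of_eventuallyEq (Filter.Eventually.of_forall fun z => ?_)
    simp only [Pi.add_apply, sub_apply, map_sub]
    abel

end EvaluationMap

/-! ### Spaces of jets -/

section JetSpace

variable {n p : ℕ} {F : Type u} [NormedAddCommGroup F] [NormedSpace ℝ F]

variable (n F) in
/-- The symmetrization of a multilinear map. -/
def symmetrization (k : ℕ) : ((Euc n) [×k]→L[ℝ] F) →L[ℝ] SymMultilinear n F k :=
  ((k.factorial : ℝ)⁻¹ • ∑ σ : Equiv.Perm (Fin k),
    ((ContinuousMultilinearMap.domDomCongrₗᵢ ℝ (Euc n) F σ).toContinuousLinearEquiv :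
      ((Euc n) [×k]→L[ℝ] F) →L[ℝ] ((Euc n) [×k]→L[ℝ] F))).codRestrict _ fun m τ v => by
    simp only [smul_apply, sum_apply]
    congr 1
    exact Fintype.sum_equiv (Equiv.mulLeft τ) _ _ fun σ => rfl

/-- Symmetrization is a projection, so it leaves actual derivatives unchanged; in `jetL` it serves
to land in the symmetric maps linearly and continuously, at every `x`. -/
theorem symmetrization_apply_of_mem {k : ℕ} {m : (Euc n) [×k]→L[ℝ] F}
    (hm : m ∈ SymMultilinear n F k) : symmetrization n F k m = ⟨m, hm⟩ := by
  refine Subtype.ext (ContinuousMultilinearMap.ext fun v => ?_)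
  have h : ∀ σ : Equiv.Perm (Fin k),
      (ContinuousMultilinearMap.domDomCongrₗᵢ ℝ (Euc n) F σ) m v = m v := fun σ => hm σ v
  change ((k.factorial : ℝ)⁻¹ • ∑ σ : Equiv.Perm (Fin k),
    ((ContinuousMultilinearMap.domDomCongrₗᵢ ℝ (Euc n) F σ).toContinuousLinearEquiv :
      ((Euc n) [×k]→L[ℝ] F) →L[ℝ] ((Euc n) [×k]→L[ℝ] F))) m v = m v
  simp only [smul_apply, sum_apply]
  change (k.factorial : ℝ)⁻¹ • ∑ σ : Equiv.Perm (Fin k),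
    (ContinuousMultilinearMap.domDomCongrₗᵢ ℝ (Euc n) F σ) m v = m v
  simp only [h, Finset.sum_const, Finset.card_univ, Fintype.card_perm, Fintype.card_fin]
  rw [← Nat.cast_smul_eq_nsmul ℝ, smul_smul, inv_mul_cancel₀ (by positivity), one_smul]

theorem isClosed_symMultilinear (k : ℕ) :
    IsClosed (SymMultilinear n F k : Set ((Euc n) [×k]→L[ℝ] F)) := by
  have h : (SymMultilinear n F k : Set ((Euc n) [×k]→L[ℝ] F)) =
      ⋂ (σ : Equiv.Perm (Fin k)) (v : Fin k → Euc n), {m | m (v ∘ σ) = m v} := by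
    ext m
    simp only [mem_iInter]
    rfl
  rw [h]
  exact isClosed_iInter fun σ => isClosed_iInter fun v =>
    isClosed_eq (by fun_prop) (by fun_prop)

instance instCompleteSpaceSymMultilinear [CompleteSpace F] (k : ℕ) :
    CompleteSpace (SymMultilinear n F k) :=
  (isClosed_symMultilinear k).completeSpace_coe

instance instNormedSpaceJetFibre : @NormedSpace ℝ (∀ k : Fin (p + 1), SymMultilinear n F (k : ℕ)) _
    Pi.normedAddCommGroup.toSeminormedAddCommGroup :=
  Pi.normedSpace

variable (n p F) in
/-- The derivatives of orders `0, ..., p` at a point of the open ball, as a linear function of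
the map of class `C^{p+1}`. -/
def jetL (x : Euc n) : CBall n (p + 1) F →L[ℝ] (∀ k : Fin (p + 1), SymMultilinear n F (k : ℕ)) :=
  ContinuousLinearMap.pi fun k =>
    symmetrization n F k ∘L CBall.evalL n (p + 1) F ⟨k, by omega⟩ x

theorem jetL_apply {x : Euc n} (hx : x ∈ ball (0 : Euc n) 1) (f : CBall n (p + 1) F)
    (k : Fin (p + 1)) :
    (jetL n p F x f k : (Euc n) [×(k : ℕ)]→L[ℝ] F) = iteratedFDeriv ℝ k f.1.toFun x := by
  have h : CBall.evalL n (p + 1) F ⟨k, by omega⟩ x f = iteratedFDeriv ℝ k f.1.toFun x :=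
    CBall.evalL_eq_iteratedFDeriv _ hx f
  change ((symmetrization n F k (CBall.evalL n (p + 1) F ⟨k, by omega⟩ x f) :
    SymMultilinear n F (k : ℕ)) : (Euc n) [×(k : ℕ)]→L[ℝ] F) = _
  have hs : iteratedFDeriv ℝ k f.1.toFun x ∈ SymMultilinear n F k := fun σ v =>
    iteratedFDeriv_symm_of_contDiffAt (k : ℕ)
      ((f.2.1.contDiffAt (isOpen_ball.mem_nhds hx)).of_le (by exact_mod_cast k.2.le)) σ v
  rw [h, symmetrization_apply_of_mem hs]

theorem jet_eq (f : CBall n (p + 1) F) (x : ball (0 : Euc n) 1) :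
    jet (Nat.le_succ p) f x = ((x : Euc n), jetL n p F x f) :=
  Prod.ext rfl (funext fun k => Subtype.ext (jetL_apply x.2 f k).symm)

theorem _root_.ContinuousLinearMap.contDiff_submodule {M : Type*} [NormedAddCommGroup M]
    [NormedSpace ℝ M] {W : Submodule ℝ M} (T : M →L[ℝ] W) : ContDiff ℝ 1 T :=
  T.contDiff

theorem contDiffOn_jetL :
    ContDiffOn ℝ 1 (fun z : Euc n × CBall n (p + 1) F => jetL n p F z.1 z.2)
      (ball 0 1 ×ˢ univ) :=
  contDiffOn_pi.mpr fun k =>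
    ContDiff.comp_contDiffOn (g := symmetrization n F k) (symmetrization n F k).contDiff_submodule
      (CBall.contDiffOn_evalL k.2)

end JetSpace

/-! ### Taylor polynomials -/

section Taylor

variable {n p r : ℕ} {F : Type u} [NormedAddCommGroup F] [NormedSpace ℝ F]

/-- The element of `C^r` of the closed ball defined by a map of class `C^r` on `ℝ^n`. -/
def CBall.ofContDiff {f : Euc n → F} (hf : ContDiff ℝ r f) : CBall n r F :=
  ⟨WithLp.toLp 1 (fun k : Fin (r + 1) => (⟨fun x => iteratedFDeriv ℝ k f x,
    (hf.continuous_iteratedFDeriv (by exact_mod_cast Nat.lt_succ_iff.mp k.2)).comp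
      continuous_subtype_val⟩ : C(closedBall (0 : Euc n) 1, (Euc n) [×(k : ℕ)]→L[ℝ] F))), by
    set g : DerivFamily n r F := WithLp.toLp 1 (fun k : Fin (r + 1) =>
      (⟨fun x => iteratedFDeriv ℝ k f x,
        (hf.continuous_iteratedFDeriv (by exact_mod_cast Nat.lt_succ_iff.mp k.2)).comp
        continuous_subtype_val⟩ : C(closedBall (0 : Euc n) 1, (Euc n) [×(k : ℕ)]→L[ℝ] F)))
    have h : EqOn g.toFun f (closedBall 0 1) := fun x hx => DerivFamily.toFun_eq hx
    refine ⟨hf.contDiffOn.congr fun x hx => h (ball_subset_closedBall hx), fun k x hx => ?_⟩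
    have he : g.toFun =ᶠ[𝓝 x] f := by
      filter_upwards [isOpen_ball.mem_nhds hx] with y hy using h (ball_subset_closedBall hy)
    exact (he.iteratedFDeriv ℝ k).eq_of_nhds.symm⟩

theorem CBall.toFun_ofContDiff {f : Euc n → F} (hf : ContDiff ℝ r f) :
    EqOn (CBall.ofContDiff hf).1.toFun f (closedBall 0 1) :=
  fun _ hx => DerivFamily.toFun_eq hx

/-- The function determines its derivatives on the open ball, and these determine their continuous
extensions by density. -/
theorem CBall.ext_of_eqOn {f g : CBall n r F} (h : EqOn f.1.toFun g.1.toFun (ball 0 1)) :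
    f = g := by
  refine Subtype.ext (DerivFamily.ext fun k => ContinuousMap.ext fun z => ?_)
  have hb : EqOn (fun x => CBall.evalL n r F k x f) (fun x => CBall.evalL n r F k x g)
      (ball 0 1) := fun x hx => by
    simp only [CBall.evalL_eq_iteratedFDeriv k hx]
    have he : f.1.toFun =ᶠ[𝓝 x] g.1.toFun := by
      filter_upwards [isOpen_ball.mem_nhds hx] with y hy using h hy
    exact (he.iteratedFDeriv ℝ k).eq_of_nhds
  have hc : ∀ f : CBall n r F, ContinuousOn (fun x => CBall.evalL n r F k x f) (closedBall 0 1) :=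
    fun f => (CBall.continuousOn_evalL_uncurry k).comp (f := fun x => (x, f))
      (continuous_id.prodMk continuous_const).continuousOn fun _ hx => ⟨hx, trivial⟩
  have hcl := hb.of_subset_closure (hc f) (hc g) ball_subset_closedBall
    (closure_ball (0 : Euc n) one_ne_zero).ge z.2
  simpa only [CBall.evalL_apply, DerivFamily.evalL_apply k z.2] using hcl

theorem CBall.tendsto_toFun {ι : Type*} {l : Filter ι} {f : ι → CBall n r F} {g : CBall n r F}
    (h : Filter.Tendsto f l (𝓝 g)) {x : Euc n} (hx : x ∈ closedBall (0 : Euc n) 1) :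
    Filter.Tendsto (fun i => (f i).1.toFun x) l (𝓝 (g.1.toFun x)) := by
  have h1 : ∀ f : CBall n r F, f.1.toFun x =
      continuousMultilinearCurryFin0 ℝ (Euc n) F (CBall.evalL n r F 0 x f) := fun f => by
    rw [DerivFamily.toFun_eq hx, CBall.evalL_apply, DerivFamily.evalL_apply 0 hx]
    exact congrArg _ (funext fun i : Fin 0 => i.elim0)
  simp only [h1]
  exact (((continuousMultilinearCurryFin0 ℝ (Euc n) F).continuous.comp
    (CBall.evalL n r F 0 x).continuous).tendsto g).comp h

/-- The Taylor polynomial at `x` with prescribed derivatives at `x`. -/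
def taylorPolynomial (x : Euc n) (a : ∀ k : Fin (p + 1), SymMultilinear n F (k : ℕ))
    (y : Euc n) : F :=
  ∑ k : Fin (p + 1), ((k : ℕ).factorial : ℝ)⁻¹ • (a k).1 (fun _ => y - x)

theorem contDiff_taylorPolynomial (x : Euc n)
    (a : ∀ k : Fin (p + 1), SymMultilinear n F (k : ℕ)) {m : WithTop ℕ∞} :
    ContDiff ℝ m (taylorPolynomial x a) :=
  ContDiff.sum fun k _ => ((a k).1.contDiff.comp
    (contDiff_pi.mpr fun _ => contDiff_id.sub contDiff_const)).const_smul _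

/-- The power series of a Taylor polynomial. -/
def taylorSeriesOfJet (a : ∀ k : Fin (p + 1), SymMultilinear n F (k : ℕ)) :
    FormalMultilinearSeries ℝ (Euc n) F := fun k =>
  if hk : k < p + 1 then (k.factorial : ℝ)⁻¹ • (a ⟨k, hk⟩).1 else 0

theorem hasFiniteFPowerSeriesOnBall_taylorPolynomial (x : Euc n)
    (a : ∀ k : Fin (p + 1), SymMultilinear n F (k : ℕ)) :
    HasFiniteFPowerSeriesOnBall (taylorPolynomial x a) (taylorSeriesOfJet a) x (p + 1) ⊤ := by
  refine .mk' (fun m hm => dif_neg (by omega)) (by simp) fun y _ => ?_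
  rw [Finset.sum_range, taylorPolynomial]
  refine Finset.sum_congr rfl fun k _ => ?_
  rw [taylorSeriesOfJet, dif_pos k.2, add_sub_cancel_left]
  rfl

theorem iteratedFDeriv_taylorPolynomial [CompleteSpace F] (x : Euc n)
    (a : ∀ k : Fin (p + 1), SymMultilinear n F (k : ℕ)) (k : Fin (p + 1)) :
    iteratedFDeriv ℝ k (taylorPolynomial x a) x = (a k).1 := by
  ext v
  rw [(hasFiniteFPowerSeriesOnBall_taylorPolynomial x
    a).toHasFPowerSeriesOnBall.iteratedFDeriv_eq_sum_of_completeSpace]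
  -- The derivative is the sum of the coefficient over all permutations; by symmetry these `k!`
  -- terms agree and cancel the factor `1 / k!`.
  have h : ∀ σ : Equiv.Perm (Fin (k : ℕ)), taylorSeriesOfJet a k (fun i => v (σ i)) =
      ((k : ℕ).factorial : ℝ)⁻¹ • (a k).1 v := fun σ => by
    rw [taylorSeriesOfJet, dif_pos k.2]
    exact congrArg (fun w => ((k : ℕ).factorial : ℝ)⁻¹ • w) ((a k).2 σ v)
  simp only [h, Finset.sum_const, Finset.card_univ, Fintype.card_perm, Fintype.card_fin]
  rw [← Nat.cast_smul_eq_nsmul ℝ, smul_smul, mul_inv_cancel₀ (by positivity), one_smul]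

/-- A Taylor polynomial at `x` is equal to its Taylor polynomial at any other point `y`. -/
theorem taylorPolynomial_eq_of_iteratedFDeriv_eq [CompleteSpace F] {x y : Euc n}
    {a b : ∀ k : Fin (p + 1), SymMultilinear n F (k : ℕ)}
    (h : ∀ k, (b k).1 = iteratedFDeriv ℝ k (taylorPolynomial x a) y) :
    taylorPolynomial y b = taylorPolynomial x a := by
  -- The radius is infinite, so recentring at `y` loses nothing and keeps the degree bound.
  have hs := (hasFiniteFPowerSeriesOnBall_taylorPolynomial x a).changeOrigin
    (y := y - x) (ENNReal.coe_lt_top)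
  rw [add_sub_cancel, ENNReal.top_sub_coe] at hs
  funext z
  rw [hs.eq_partialSum' z (by simp) _ le_rfl, FormalMultilinearSeries.partialSum,
    Finset.sum_range, taylorPolynomial]
  refine Finset.sum_congr rfl fun k _ => ?_
  rw [h, hs.toHasFPowerSeriesOnBall.iteratedFDeriv_eq_sum_of_completeSpace]
  simp only [Finset.sum_const, Finset.card_univ, Fintype.card_perm, Fintype.card_fin]
  rw [← Nat.cast_smul_eq_nsmul ℝ, smul_smul, inv_mul_cancel₀ (by positivity), one_smul]

/-- The Taylor polynomial at `x` as a linear function of the derivatives at `x`. -/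
def taylorMap (x : Euc n) : (∀ k : Fin (p + 1), SymMultilinear n F (k : ℕ)) →ₗ[ℝ] CBall n r F where
  toFun a := CBall.ofContDiff (contDiff_taylorPolynomial x a)
  map_add' a b := CBall.ext_of_eqOn fun y hy => by
    have hy' := ball_subset_closedBall hy
    rw [CBall.toFun_ofContDiff _ hy', Submodule.coe_add, DerivFamily.toFun_add, Pi.add_apply,
      CBall.toFun_ofContDiff _ hy', CBall.toFun_ofContDiff _ hy', taylorPolynomial,
      taylorPolynomial, taylorPolynomial, ← Finset.sum_add_distrib]
    exact Finset.sum_congr rfl fun k _ => smul_add _ _ _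
  map_smul' c a := CBall.ext_of_eqOn fun y hy => by
    have hy' := ball_subset_closedBall hy
    rw [CBall.toFun_ofContDiff _ hy', Submodule.coe_smul, DerivFamily.toFun_smul, Pi.smul_apply,
      CBall.toFun_ofContDiff _ hy', taylorPolynomial, taylorPolynomial, Finset.smul_sum]
    exact Finset.sum_congr rfl fun k _ => smul_comm _ _ _

theorem taylorMap_apply (x : Euc n) (a : ∀ k : Fin (p + 1), SymMultilinear n F (k : ℕ)) :
    taylorMap (r := r) x a = CBall.ofContDiff (contDiff_taylorPolynomial x a) := rfl

/-- The closed graph theorem replaces estimates of all derivatives by pointwise convergence of the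
polynomials. -/
theorem continuous_taylorMap [CompleteSpace F] (x : Euc n) :
    Continuous (taylorMap x :
      (∀ k : Fin (p + 1), SymMultilinear n F (k : ℕ)) →ₗ[ℝ] CBall n r F) := by
  refine LinearMap.continuous_of_seq_closed_graph _ fun u a g hu hg => ?_
  refine CBall.ext_of_eqOn fun y hy => ?_
  have hy' := ball_subset_closedBall hy
  refine tendsto_nhds_unique (CBall.tendsto_toFun hg hy') ?_
  simp only [Function.comp_apply, taylorMap_apply, CBall.toFun_ofContDiff _ hy']
  refine tendsto_finsetSum _ fun k _ => Filter.Tendsto.const_smul ?_ _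
  have h1 : Continuous fun m : (Euc n) [×(k : ℕ)]→L[ℝ] F => m fun _ => y - x := by fun_prop
  exact ((h1.comp (continuous_subtype_val.comp (continuous_apply k))).tendsto a).comp hu

theorem jetL_taylorMap_apply {x y : Euc n} (hy : y ∈ ball (0 : Euc n) 1)
    (a : ∀ k : Fin (p + 1), SymMultilinear n F (k : ℕ)) (k : Fin (p + 1)) :
    (jetL n p F y (taylorMap x a) k).1 = iteratedFDeriv ℝ k (taylorPolynomial x a) y := by
  have he : (taylorMap (r := p + 1) x a).1.toFun =ᶠ[𝓝 y] taylorPolynomial x a := by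
    filter_upwards [isOpen_ball.mem_nhds hy] with z hz using
      CBall.toFun_ofContDiff (contDiff_taylorPolynomial x a) (ball_subset_closedBall hz)
  rw [jetL_apply hy]
  exact (he.iteratedFDeriv ℝ k).eq_of_nhds

theorem jetL_taylorMap [CompleteSpace F] {x : Euc n} (hx : x ∈ ball (0 : Euc n) 1)
    (a : ∀ k : Fin (p + 1), SymMultilinear n F (k : ℕ)) :
    jetL n p F x (taylorMap x a) = a :=
  funext fun k => Subtype.ext ((jetL_taylorMap_apply hx a k).trans
    (iteratedFDeriv_taylorPolynomial x a k))

/-- The space of polynomials of degree at most `p` does not depend on the centre of expansion; this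
is what allows a single complement `K` for all base points. -/
theorem taylorMap_jetL_taylorMap [CompleteSpace F] {x y : Euc n} (hy : y ∈ ball (0 : Euc n) 1)
    (a : ∀ k : Fin (p + 1), SymMultilinear n F (k : ℕ)) :
    (taylorMap y (jetL n p F y (taylorMap x a)) : CBall n (p + 1) F) = taylorMap x a := by
  refine CBall.ext_of_eqOn fun z hz => ?_
  have hz' := ball_subset_closedBall hz
  rw [taylorMap_apply y, taylorMap_apply x a, CBall.toFun_ofContDiff _ hz',
    CBall.toFun_ofContDiff _ hz']
  exact congrFun (taylorPolynomial_eq_of_iteratedFDeriv_eq (jetL_taylorMap_apply hy a)) z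

end Taylor

/-! ### Maps whose jets meet a rectifiable set -/

section Jets

variable {n p : ℕ} {F : Type u} [NormedAddCommGroup F] [NormedSpace ℝ F] [CompleteSpace F]

variable (n p F) in
/-- The map sending a function to its remainder in the Taylor expansion at the origin, with values
in the space of functions with vanishing derivatives of orders `0, ..., p` at the origin. -/
def taylorRemainder : CBall n (p + 1) F →L[ℝ] (jetL n p F 0).ker :=
  (ContinuousLinearMap.id ℝ (CBall n (p + 1) F) -
    (⟨taylorMap 0, continuous_taylorMap 0⟩ :
      (∀ k : Fin (p + 1), SymMultilinear n F (k : ℕ)) →L[ℝ] CBall n (p + 1) F) ∘L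
      jetL n p F 0).codRestrict _ fun f => by
    have h : jetL n p F 0 (f - taylorMap 0 (jetL n p F 0 f)) = 0 := by
      rw [map_sub, jetL_taylorMap (mem_ball_self one_pos), sub_self]
    exact h

theorem coe_taylorRemainder (f : CBall n (p + 1) F) :
    (taylorRemainder n p F f : CBall n (p + 1) F) = f - taylorMap 0 (jetL n p F 0 f) := rfl

/-- A map with zero remainder is a polynomial, and a polynomial with zero jet at `x` vanishes. For
surjectivity, adding a polynomial adjusts the jet at `x` without changing the remainder. -/
theorem bijective_jetL_taylorRemainder {x : Euc n} (hx : x ∈ ball (0 : Euc n) 1) :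
    Function.Bijective fun f => (jetL n p F x f, taylorRemainder n p F f) := by
  have h0 : (0 : Euc n) ∈ ball (0 : Euc n) 1 := mem_ball_self one_pos
  constructor
  · intro f g hfg
    have h1 : jetL n p F x (f - g) = 0 := by
      rw [map_sub, sub_eq_zero]; exact congrArg Prod.fst hfg
    have h2 : f - g = taylorMap 0 (jetL n p F 0 (f - g)) := by
      rw [← sub_eq_zero, ← coe_taylorRemainder, map_sub]
      exact congrArg Subtype.val (sub_eq_zero.mpr (congrArg Prod.snd hfg))
    have h3 := taylorMap_jetL_taylorMap hx (x := (0 : Euc n)) (jetL n p F 0 (f - g))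
    rw [← h2, h1, map_zero] at h3
    exact sub_eq_zero.mp h3.symm
  · rintro ⟨a, k⟩
    have hk : jetL n p F 0 k = 0 := k.2
    -- The polynomial that corrects the jet of `k` at `x` to `a`.
    set s : CBall n (p + 1) F := taylorMap x (a - jetL n p F x k) with hs
    have hs0 : taylorMap 0 (jetL n p F 0 s) = s := taylorMap_jetL_taylorMap h0 _
    refine ⟨s + k, Prod.ext ?_ (Subtype.ext ?_)⟩
    · change jetL n p F x (s + k) = a
      rw [map_add, hs, jetL_taylorMap hx, sub_add_cancel]
    · rw [coe_taylorRemainder, map_add, hk, add_zero, hs0, add_sub_cancel_left]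

end Jets

end RectJets

end

theorem proposition2p9 {F : Type*} [NormedAddCommGroup F] [NormedSpace ℝ F] [CompleteSpace F]
    [TopologicalSpace.SeparableSpace F] (n p d : ℕ) (hnd : n < d)
    (A : Set (RectJets.Jets n p F)) (hAJ : A ⊆ RectJets.jetsOverClosedBall n p F)
    (hA : RectJets.IsRectifiable d A) :
    RectJets.IsRectifiable (d - n)
      {f : RectJets.CBall n (p + 1) F |
        (Set.range (RectJets.jet (Nat.le_succ p) f) ∩ A).Nonempty} := by
  have hn : Module.finrank ℝ (RectJets.Euc n) = n := finrank_euclideanSpace_fin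
  have : CompleteSpace (RectJets.jetL n p F 0).ker :=
    (RectJets.jetL n p F 0).isClosed_ker.completeSpace_coe
  have h := RectJets.IsRectifiable.setOf_exists_evaluation_mem Metric.isOpen_ball
    RectJets.contDiffOn_jetL (RectJets.jetL n p F) (RectJets.taylorRemainder n p F)
    (fun _ _ _ => rfl) (fun _ hx => RectJets.bijective_jetL_taylorRemainder hx)
    (hn.trans_le hnd.le) hA
  rw [hn] at h
  convert h using 1
  ext f
  constructor
  · rintro ⟨_, ⟨x, rfl⟩, hx⟩
    exact ⟨x, x.2, RectJets.jet_eq f x ▸ hx⟩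
  · rintro ⟨x, hx, hxA⟩
    exact ⟨_, ⟨⟨x, hx⟩, rfl⟩, (RectJets.jet_eq f ⟨x, hx⟩).symm ▸ hxA⟩
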